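/- **Conventions.** Graphs are finite directed multigraphs $G=(V,E)$ (parallel edges allowed) with a source $s$ and a sink $t$. A *flow* on $G$ is a function $X$ on $E$ that satisfies conservation of flow at every vertex other than $s$ and $t$; $|X|$ is the total flow on the edges leaving $s$. For a non-negative flow $X$, $G|_X$ is the spanning subgraph formed by the edges $e$ with $X(e)\neq 0$. The *width* of a graph is the minimum number of $s$-$t$ paths needed to cover all of its edges. $G$ is *width-stable* if $\mathrm{width}(G|_X)\le \mathrm{width}(G|_Y)$ for all non-negative real-valued flows $X\le Y$ on $G$. A *two-terminal series-parallel graph* with terminals $s,t$ is a graph that either consists of a single edge from $s$ to $t$ and no other vertices, or is obtained from two (disjoint) two-terminal series-parallel graphs $G_1,G_2$ with terminals $s_1,t_1$ and $s_2,t_2$ by parallel composition (identify $s=s_1=s_2$ and $t=t_1=t_2$) or by series composition (identify $t_1=s_2$, and put $s=s_1$, $t=t_2$). A *flow decomposition* of $(G,X)$ over $\mathbb N$ of size $k$ is a family of $s$-$t$ paths $P_1,\dots,P_k$ with weights $w_1,\dots,w_k\in\mathbb N$ such that $X=\sum_i w_iP_i$, where $P_i$ also denotes the flow that is $1$ on the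 edges of $P_i$ and $0$ elsewhere. $\mathrm{mfd}_{\mathbb N}(G,X)$ is the smallest size of such a decomposition. A path *carries* flow $w$ if $X(e)\ge w$ for each of its edges $e$. *Greedy-weight* is the following algorithm: as long as $X\ne 0$, choose an $s$-$t$ path $P$ that carries the largest flow (ties broken arbitrarily), let $w$ be the largest flow that $P$ carries, output $P$ with weight $w$, and replace $X$ by $X-wP$. **Statement.** (1) Every two-terminal series-parallel graph is width-stable. (2) Greedy-weight is an $O(\log|X|)$-approximation for minimum flow decomposition over $\mathbb N$ on two-terminal series-parallel graphs. That is, there is an absolute constant $C$ such that for every two-terminal series-parallel graph $G$ and every flow $X:E\to\mathbb N$, greedy-weight (however ties are broken) never gets stuck, terminates, and outputs a flow decomposition of $(G,X)$; its size is at most $C\log|X|\cdot \mathrm{mfd}_{\mathbb N}(G,X)$ if $|X|\ge 2$, and it is exactly $\mathrm{mfd}_{\mathbb N}(G,X)$ if $|X|\le 1$. -/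

import Mathlib

universe u v

set_option linter.checkUnivs false

/-- A finite directed multigraph (parallel edges allowed) with two distinguished vertices,
the source `s` and the sink `t`. -/
structure STGraph where
  V : Type u
  E : Type v
  [finiteV : Finite V]
  [fintypeE : Fintype E]
  src : E → V
  tgt : E → V
  s : V
  t : V

namespace STGraph

attribute [instance] STGraph.finiteV STGraph.fintypeE

/-! ### Paths -/

/-- `G.IsWalk a p b`: the consecutive edges of the list `p` lead from `a` to `b`. -/
def IsWalk (G : STGraph.{u, v}) : G.V → List G.E → G.V → Prop
  | a, [], b => a = b
  | a, e :: p, b => G.src e = a ∧ G.IsWalk (G.tgt e) p b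

/-- `G.IsPath a p b`: the list of edges `p` is a directed path from `a` to `b`, that is, a walk
that visits no vertex twice. -/
def IsPath (G : STGraph.{u, v}) (a : G.V) (p : List G.E) (b : G.V) : Prop :=
  G.IsWalk a p b ∧ (a :: p.map G.tgt).Nodup

/-- `p` is an `s`-`t` path. -/
def IsSTPath (G : STGraph.{u, v}) (p : List G.E) : Prop :=
  G.IsPath G.s p G.t

/-! ### Flows -/

open Classical in
/-- Conservation of flow at every vertex other than `s` and `t`. -/
def IsFlow (G : STGraph.{u, v}) {Y : Type*} [AddCommMonoid Y] (X : G.E → Y) : Prop :=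
  ∀ a : G.V, a ≠ G.s → a ≠ G.t →
    ∑ e with G.tgt e = a, X e = ∑ e with G.src e = a, X e

open Classical in
/-- The total flow `|X|` out of `s`. -/
noncomputable def flowValue (G : STGraph.{u, v}) {Y : Type*} [AddCommMonoid Y]
    (X : G.E → Y) : Y :=
  ∑ e with G.src e = G.s, X e

open Classical in
/-- The flow with value `1` on the edges of `p` and `0` on all other edges. -/
noncomputable def pathFlow (G : STGraph.{u, v}) (p : List G.E) : G.E → ℕ :=
  fun e => if e ∈ p then 1 else 0

/-! ### Width and width-stability -/

/-- The spanning subgraph `G|_X` that consists of the edges `e` with `X e ≠ 0`. -/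
noncomputable def restrict (G : STGraph.{u, v}) {Y : Type*} [Zero Y] (X : G.E → Y) :
    STGraph.{u, v} where
  V := G.V
  E := {e : G.E // X e ≠ 0}
  fintypeE := Fintype.ofFinite _
  src e := G.src e.1
  tgt e := G.tgt e.1
  s := G.s
  t := G.t

/-- The family `P` consists of `s`-`t` paths that together contain every edge. -/
def IsPathCover (G : STGraph.{u, v}) (P : List (List G.E)) : Prop :=
  (∀ p ∈ P, G.IsSTPath p) ∧ ∀ e : G.E, ∃ p ∈ P, e ∈ p

/-- The minimum number of `s`-`t` paths that cover all edges (`⊤` if there is no path cover). -/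
noncomputable def width (G : STGraph.{u, v}) : ℕ∞ :=
  ⨅ (P : List (List G.E)) (_ : G.IsPathCover P), (P.length : ℕ∞)

/-- For all non-negative flows `X ≤ Y`, the width of `G|_X` is at most the width of `G|_Y`. -/
def WidthStable (G : STGraph.{u, v}) : Prop :=
  ∀ X Y : G.E → ℝ, G.IsFlow X → G.IsFlow Y → 0 ≤ X → X ≤ Y →
    (G.restrict X).width ≤ (G.restrict Y).width

/-! ### Minimum flow decomposition over `ℕ` -/

/-- The weighted `s`-`t` paths `D` decompose `X`; the size of the decomposition is the length
of `D`. -/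
def IsFlowDecomposition (G : STGraph.{u, v}) (X : G.E → ℕ) (D : List (List G.E × ℕ)) : Prop :=
  (∀ d ∈ D, G.IsSTPath d.1) ∧ X = (D.map fun d => d.2 • G.pathFlow d.1).sum

/-- The smallest size of a flow decomposition of `(G, X)` with weights in `ℕ`. -/
noncomputable def mfdSize (G : STGraph.{u, v}) (X : G.E → ℕ) : ℕ :=
  sInf {k | ∃ D : List (List G.E × ℕ), G.IsFlowDecomposition X D ∧ D.length = k}

/-! ### The algorithm greedy-weight -/

/-- `p` carries flow `w`. -/
def Carries (G : STGraph.{u, v}) (X : G.E → ℕ) (p : List G.E) (w : ℕ) : Prop :=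
  ∀ e ∈ p, w ≤ X e

/-- One step of greedy-weight at the flow `X`: `p` is a heaviest `s`-`t` path, `w` is the largest
flow that it carries, and removing `w` units of flow along `p` leaves `X'`. Ties between heaviest
paths may be broken arbitrarily. -/
def GreedyStep (G : STGraph.{u, v}) (X : G.E → ℕ) (p : List G.E) (w : ℕ) (X' : G.E → ℕ) : Prop :=
  G.IsSTPath p ∧ G.Carries X p w ∧
    (∀ q w', G.IsSTPath q → G.Carries X q w' → w' ≤ w) ∧
    X = X' + w • G.pathFlow p

/-- `G.GreedyRun X L X'`: starting from `X`, greedy-weight can remove in this order the weighted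
paths listed in `L`, which leaves `X'`. It takes no further step once the flow is `0`. -/
inductive GreedyRun (G : STGraph.{u, v}) :
    (G.E → ℕ) → List (List G.E × ℕ) → (G.E → ℕ) → Prop
  | nil (X : G.E → ℕ) : GreedyRun G X [] X
  | cons {X X' X'' : G.E → ℕ} {p : List G.E} {w : ℕ} {L : List (List G.E × ℕ)} :
      X ≠ 0 → G.GreedyStep X p w X' → GreedyRun G X' L X'' → GreedyRun G X ((p, w) :: L) X''

/-- Greedy-weight solves minimum flow decomposition over `ℕ` on `(G, X)` within the factor `α`,
however ties are broken: it never gets stuck before the flow is `0`, it terminates, and its output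
is always a flow decomposition of size at most `α` times the minimum size. -/
structure GreedyApproximates (G : STGraph.{u, v}) (X : G.E → ℕ) (α : ℝ) : Prop where
  progress : ∀ L X', G.GreedyRun X L X' → X' ≠ 0 → ∃ p w X'', G.GreedyStep X' p w X''
  terminates : Acc (fun X₂ X₁ : G.E → ℕ => X₁ ≠ 0 ∧ ∃ p w, G.GreedyStep X₁ p w X₂) X
  isFlowDecomposition : ∀ L, G.GreedyRun X L 0 → G.IsFlowDecomposition X L
  length_le : ∀ L, G.GreedyRun X L 0 → (L.length : ℝ) ≤ α * (G.mfdSize X : ℝ)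

/-! ### Two-terminal series-parallel graphs -/

/-- `G` is a single edge from `s` to `t` and has no other vertices. -/
def IsSingleEdge (G : STGraph.{u, v}) : Prop :=
  G.s ≠ G.t ∧ (∀ a : G.V, a = G.s ∨ a = G.t) ∧
    ∃ e : G.E, (∀ e' : G.E, e' = e) ∧ G.src e = G.s ∧ G.tgt e = G.t

/-- `f₁`, `f₂` (on vertices) and `φ` (on edges) exhibit `G` as the disjoint union of `G₁` and `G₂`
in which a vertex `a` of `G₁` and a vertex `b` of `G₂` are identified exactly if `R a b`. -/
structure IsGluing (G₁ G₂ G : STGraph.{u, v}) (R : G₁.V → G₂.V → Prop)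
    (f₁ : G₁.V → G.V) (f₂ : G₂.V → G.V) (φ : G₁.E ⊕ G₂.E ≃ G.E) : Prop where
  injective_left : Function.Injective f₁
  injective_right : Function.Injective f₂
  cover : ∀ c : G.V, (∃ a, f₁ a = c) ∨ ∃ b, f₂ b = c
  eq_iff : ∀ a b, f₁ a = f₂ b ↔ R a b
  src_left : ∀ e, G.src (φ (Sum.inl e)) = f₁ (G₁.src e)
  tgt_left : ∀ e, G.tgt (φ (Sum.inl e)) = f₁ (G₁.tgt e)
  src_right : ∀ e, G.src (φ (Sum.inr e)) = f₂ (G₂.src e)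
  tgt_right : ∀ e, G.tgt (φ (Sum.inr e)) = f₂ (G₂.tgt e)

/-- `G` arises from disjoint copies of `G₁` and `G₂` by identifying `s = s₁ = s₂` and
`t = t₁ = t₂`. -/
def IsParallelComposition (G₁ G₂ G : STGraph.{u, v}) : Prop :=
  ∃ f₁ f₂ φ,
    IsGluing G₁ G₂ G (fun a b => (a = G₁.s ∧ b = G₂.s) ∨ (a = G₁.t ∧ b = G₂.t)) f₁ f₂ φ ∧
      G.s = f₁ G₁.s ∧ G.t = f₁ G₁.t

/-- `G` arises from disjoint copies of `G₁` and `G₂` by identifying `t₁ = s₂`, with `s = s₁` and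
`t = t₂`. -/
def IsSeriesComposition (G₁ G₂ G : STGraph.{u, v}) : Prop :=
  ∃ f₁ f₂ φ,
    IsGluing G₁ G₂ G (fun a b => a = G₁.t ∧ b = G₂.s) f₁ f₂ φ ∧
      G.s = f₁ G₁.s ∧ G.t = f₂ G₂.t

/-- Two-terminal series-parallel graphs with terminals `s` and `t`. -/
inductive IsSeriesParallel : STGraph.{u, v} → Prop
  | single {G : STGraph.{u, v}} : G.IsSingleEdge → IsSeriesParallel G
  | parallel {G₁ G₂ G : STGraph.{u, v}} : IsSeriesParallel G₁ → IsSeriesParallel G₂ →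
      IsParallelComposition G₁ G₂ G → IsSeriesParallel G
  | series {G₁ G₂ G : STGraph.{u, v}} : IsSeriesParallel G₁ → IsSeriesParallel G₂ →
      IsSeriesComposition G₁ G₂ G → IsSeriesParallel G

end STGraph

/-! Everything rests on induction over the series-parallel construction. An `s`-`t` path of a
parallel composition lies in one of the two parts; an `s`-`t` path of a series composition is a path
of the first part followed by one of the second. Hence path covers split into covers of the parts,
whose sizes add in the parallel case; conversely, nonempty covers of two parts in series combine
into one whose size is the maximum. Flows restrict to flows on the parts. In parallel the values
add; in series both parts carry the whole value, so a nonzero non-negative flow is nonzero on both.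

Width-stability follows: a cover of an edge set containing the support of a non-negative flow can be
turned, part by part, into a cover of exactly that support by no more paths
(`IsSeriesParallel.exists_covers_support`).

For greedy-weight, the same induction shows that if `k` paths cover the support of `X`, then some
path carries at least `|X| / k` (`IsSeriesParallel.exists_carries`). The paths of positive weight in
an optimal decomposition form such a cover, so `k` is at most `mfdSize`. Supports only shrink during
a run, so by the covering lemma the same `k` serves at every step. Each step therefore removes at
least a `k`-th part of the remaining flow and, until the last step, lowers its logarithm by at least
`1 / k`; this bounds the number of steps by `k * (1 + log |X|)` (`GreedyRun.length_le_of_covers`).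
-/

namespace STGraph

/-! ### Flow through a vertex -/

open Classical in
/-- The total flow on the edges that enter `a`. -/
noncomputable def inflow (G : STGraph.{u, v}) {Y : Type*} [AddCommMonoid Y]
    (X : G.E → Y) (a : G.V) : Y :=
  ∑ e with G.tgt e = a, X e

open Classical in
/-- The total flow on the edges that leave `a`. -/
noncomputable def outflow (G : STGraph.{u, v}) {Y : Type*} [AddCommMonoid Y]
    (X : G.E → Y) (a : G.V) : Y :=
  ∑ e with G.src e = a, X e

theorem inflow_eq_zero {G : STGraph.{u, v}} {Y : Type*} [AddCommMonoid Y] (X : G.E → Y)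
    {a : G.V} (h : ∀ e, G.tgt e ≠ a) : G.inflow X a = 0 := by
  simp [inflow, h]

theorem outflow_eq_zero {G : STGraph.{u, v}} {Y : Type*} [AddCommMonoid Y] (X : G.E → Y)
    {a : G.V} (h : ∀ e, G.src e ≠ a) : G.outflow X a = 0 := by
  simp [outflow, h]

theorem flowValue_nonneg {G : STGraph.{u, v}} {Y : Type*} [AddCommMonoid Y] [PartialOrder Y]
    [IsOrderedAddMonoid Y] {X : G.E → Y} (hX : 0 ≤ X) : 0 ≤ G.flowValue X :=
  Finset.sum_nonneg fun e _ => hX e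

theorem flowValue_zero {G : STGraph.{u, v}} {Y : Type*} [AddCommMonoid Y] :
    G.flowValue (0 : G.E → Y) = 0 := by
  simp [flowValue]

theorem IsFlow.inflow_eq_outflow {G : STGraph.{u, v}} {Y : Type*} [AddCommMonoid Y]
    {X : G.E → Y} (hX : G.IsFlow X) {a : G.V} (hs : a ≠ G.s) (ht : a ≠ G.t) :
    G.inflow X a = G.outflow X a :=
  hX a hs ht

/-! ### Walks and paths -/

theorem isWalk_append {G : STGraph.{u, v}} {a c : G.V} {p q : List G.E} :
    G.IsWalk a (p ++ q) c ↔ ∃ b, G.IsWalk a p b ∧ G.IsWalk b q c := by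
  induction p generalizing a with
  | nil => simp [IsWalk]
  | cons e p ih => simp [IsWalk, ih, and_assoc]

/-! ### Gluings -/

namespace IsGluing

variable {G₁ G₂ G : STGraph.{u, v}} {R : G₁.V → G₂.V → Prop} {f₁ : G₁.V → G.V}
  {f₂ : G₂.V → G.V} {φ : G₁.E ⊕ G₂.E ≃ G.E}

/-- Lets facts about the right part be read off from their left-hand versions. -/
theorem symm (h : IsGluing G₁ G₂ G R f₁ f₂ φ) :
    IsGluing G₂ G₁ G (fun b a => R a b) f₂ f₁ ((Equiv.sumComm _ _).trans φ) where
  injective_left := h.injective_right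
  injective_right := h.injective_left
  cover c := (h.cover c).symm
  eq_iff b a := by rw [eq_comm, h.eq_iff]
  src_left := h.src_right
  tgt_left := h.tgt_right
  src_right := h.src_left
  tgt_right := h.tgt_left

theorem isWalk_map_left (h : IsGluing G₁ G₂ G R f₁ f₂ φ) {a b : G₁.V} {p : List G₁.E} :
    G.IsWalk (f₁ a) (p.map fun e => φ (.inl e)) (f₁ b) ↔ G₁.IsWalk a p b := by
  induction p generalizing a with
  | nil => simp [IsWalk, h.injective_left.eq_iff]
  | cons e p ih => simp [IsWalk, h.src_left, h.tgt_left, h.injective_left.eq_iff, ih]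

theorem map_tgt_left (h : IsGluing G₁ G₂ G R f₁ f₂ φ) (p : List G₁.E) :
    (p.map fun e => φ (.inl e)).map G.tgt = (p.map G₁.tgt).map f₁ := by
  simp [h.tgt_left]

theorem map_tgt_right (h : IsGluing G₁ G₂ G R f₁ f₂ φ) (p : List G₂.E) :
    (p.map fun e => φ (.inr e)).map G.tgt = (p.map G₂.tgt).map f₂ :=
  h.symm.map_tgt_left p

theorem isPath_map_left (h : IsGluing G₁ G₂ G R f₁ f₂ φ) {a b : G₁.V} {p : List G₁.E} :
    G.IsPath (f₁ a) (p.map fun e => φ (.inl e)) (f₁ b) ↔ G₁.IsPath a p b := by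
  rw [IsPath, IsPath, h.isWalk_map_left, h.map_tgt_left, ← List.map_cons,
    List.nodup_map_iff h.injective_left]

variable {Y : Type*} [AddCommMonoid Y]

open Classical in
theorem inflow_eq (h : IsGluing G₁ G₂ G R f₁ f₂ φ) (X : G.E → Y) (c : G.V) :
    G.inflow X c = ∑ e with f₁ (G₁.tgt e) = c, X (φ (.inl e)) +
      ∑ e with f₂ (G₂.tgt e) = c, X (φ (.inr e)) := by
  simp only [inflow, Finset.sum_filter]
  rw [← φ.sum_comp, Fintype.sum_sum_type]
  simp only [h.tgt_left, h.tgt_right]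

open Classical in
theorem outflow_eq (h : IsGluing G₁ G₂ G R f₁ f₂ φ) (X : G.E → Y) (c : G.V) :
    G.outflow X c = ∑ e with f₁ (G₁.src e) = c, X (φ (.inl e)) +
      ∑ e with f₂ (G₂.src e) = c, X (φ (.inr e)) := by
  simp only [outflow, Finset.sum_filter]
  rw [← φ.sum_comp, Fintype.sum_sum_type]
  simp only [h.src_left, h.src_right]

theorem inflow_left (h : IsGluing G₁ G₂ G R f₁ f₂ φ) (X : G.E → Y) {a : G₁.V}
    (ha : ∀ b, ¬ R a b) : G.inflow X (f₁ a) = G₁.inflow (fun e => X (φ (.inl e))) a := by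
  have hne (b) : f₂ b ≠ f₁ a := fun hb => ha b ((h.eq_iff a b).1 hb.symm)
  classical
  rw [h.inflow_eq]
  simp [h.injective_left.eq_iff, hne, inflow]

theorem outflow_left (h : IsGluing G₁ G₂ G R f₁ f₂ φ) (X : G.E → Y) {a : G₁.V}
    (ha : ∀ b, ¬ R a b) : G.outflow X (f₁ a) = G₁.outflow (fun e => X (φ (.inl e))) a := by
  have hne (b) : f₂ b ≠ f₁ a := fun hb => ha b ((h.eq_iff a b).1 hb.symm)
  classical
  rw [h.outflow_eq]
  simp [h.injective_left.eq_iff, hne, outflow]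

theorem inflow_glued (h : IsGluing G₁ G₂ G R f₁ f₂ φ) (X : G.E → Y) {a : G₁.V} {b : G₂.V}
    (hab : R a b) : G.inflow X (f₁ a) =
      G₁.inflow (fun e => X (φ (.inl e))) a + G₂.inflow (fun e => X (φ (.inr e))) b := by
  have hb (c) : f₂ c = f₁ a ↔ c = b := by
    rw [(h.eq_iff a b).2 hab, h.injective_right.eq_iff]
  classical
  rw [h.inflow_eq]
  simp [h.injective_left.eq_iff, hb, inflow]

theorem outflow_glued (h : IsGluing G₁ G₂ G R f₁ f₂ φ) (X : G.E → Y) {a : G₁.V} {b : G₂.V}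
    (hab : R a b) : G.outflow X (f₁ a) =
      G₁.outflow (fun e => X (φ (.inl e))) a + G₂.outflow (fun e => X (φ (.inr e))) b := by
  have hb (c) : f₂ c = f₁ a ↔ c = b := by
    rw [(h.eq_iff a b).2 hab, h.injective_right.eq_iff]
  classical
  rw [h.outflow_eq]
  simp [h.injective_left.eq_iff, hb, outflow]

/-- An inner vertex of `G₁` that is neither identified with a vertex of `G₂` nor a terminal of `G`
meets the same edges in both graphs, so conservation is inherited. -/
theorem isFlow_left (h : IsGluing G₁ G₂ G R f₁ f₂ φ) {X : G.E → Y} (hX : G.IsFlow X)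
    (hR : ∀ a, a ≠ G₁.s → a ≠ G₁.t → (∀ b, ¬ R a b) ∧ f₁ a ≠ G.s ∧ f₁ a ≠ G.t) :
    G₁.IsFlow fun e => X (φ (.inl e)) := by
  intro a hs ht
  obtain ⟨hb, hs', ht'⟩ := hR a hs ht
  exact (h.inflow_left X hb).symm.trans
    ((hX.inflow_eq_outflow hs' ht').trans (h.outflow_left X hb))

end IsGluing

/-! ### Terminals of compositions -/

/-- The two terminals differ, no edge enters the source, and no edge leaves the sink. -/
structure HasProperTerminals (G : STGraph.{u, v}) : Prop where
  s_ne_t : G.s ≠ G.t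
  tgt_ne_s : ∀ e, G.tgt e ≠ G.s
  src_ne_t : ∀ e, G.src e ≠ G.t

section Parallel

variable {G₁ G₂ G : STGraph.{u, v}} {f₁ : G₁.V → G.V} {f₂ : G₂.V → G.V}
  {φ : G₁.E ⊕ G₂.E ≃ G.E}

/-- The maps `f₁`, `f₂`, `φ` exhibit `G` as the parallel composition of `G₁` and `G₂`. -/
structure IsParallelVia (G₁ G₂ G : STGraph.{u, v}) (f₁ : G₁.V → G.V) (f₂ : G₂.V → G.V)
    (φ : G₁.E ⊕ G₂.E ≃ G.E) : Prop where
  gluing : IsGluing G₁ G₂ G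
    (fun a b => (a = G₁.s ∧ b = G₂.s) ∨ (a = G₁.t ∧ b = G₂.t)) f₁ f₂ φ
  s_eq : G.s = f₁ G₁.s
  t_eq : G.t = f₁ G₁.t

namespace IsParallelVia

theorem s_eq_right (h : IsParallelVia G₁ G₂ G f₁ f₂ φ) : G.s = f₂ G₂.s := by
  rw [h.s_eq, h.gluing.eq_iff]; simp

theorem t_eq_right (h : IsParallelVia G₁ G₂ G f₁ f₂ φ) : G.t = f₂ G₂.t := by
  rw [h.t_eq, h.gluing.eq_iff]; simp

theorem symm (h : IsParallelVia G₁ G₂ G f₁ f₂ φ) :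
    IsParallelVia G₂ G₁ G f₂ f₁ ((Equiv.sumComm _ _).trans φ) where
  gluing := by
    have := h.gluing.symm
    simp only [and_comm] at this ⊢
    exact this
  s_eq := h.s_eq_right
  t_eq := h.t_eq_right

theorem tgt_left_ne_s (h : IsParallelVia G₁ G₂ G f₁ f₂ φ) (h₁ : G₁.HasProperTerminals)
    (e : G₁.E) : G.tgt (φ (.inl e)) ≠ G.s := by
  rw [h.gluing.tgt_left, h.s_eq, h.gluing.injective_left.ne_iff]
  exact h₁.tgt_ne_s e

theorem src_left_ne_t (h : IsParallelVia G₁ G₂ G f₁ f₂ φ) (h₁ : G₁.HasProperTerminals)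
    (e : G₁.E) : G.src (φ (.inl e)) ≠ G.t := by
  rw [h.gluing.src_left, h.t_eq, h.gluing.injective_left.ne_iff]
  exact h₁.src_ne_t e

theorem hasProperTerminals (h : IsParallelVia G₁ G₂ G f₁ f₂ φ) (h₁ : G₁.HasProperTerminals)
    (h₂ : G₂.HasProperTerminals) : G.HasProperTerminals where
  s_ne_t := by
    rw [h.s_eq, h.t_eq, h.gluing.injective_left.ne_iff]
    exact h₁.s_ne_t
  tgt_ne_s e := by
    obtain ⟨e | e, rfl⟩ := φ.surjective e
    exacts [h.tgt_left_ne_s h₁ e, h.symm.tgt_left_ne_s h₂ e]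
  src_ne_t e := by
    obtain ⟨e | e, rfl⟩ := φ.surjective e
    exacts [h.src_left_ne_t h₁ e, h.symm.src_left_ne_t h₂ e]

theorem isSTPath_map_left (h : IsParallelVia G₁ G₂ G f₁ f₂ φ) {p : List G₁.E} :
    G.IsSTPath (p.map fun e => φ (.inl e)) ↔ G₁.IsSTPath p := by
  rw [IsSTPath, h.s_eq, h.t_eq, h.gluing.isPath_map_left, IsSTPath]

theorem isSTPath_map_right (h : IsParallelVia G₁ G₂ G f₁ f₂ φ) {p : List G₂.E} :
    G.IsSTPath (p.map fun e => φ (.inr e)) ↔ G₂.IsSTPath p :=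
  h.symm.isSTPath_map_left

/-- The parts meet only in `s` and `t`. The walk never returns to `s`, and no edge of `G₂` leaves
`t`, so it cannot change sides. -/
theorem exists_eq_map_left_of_isWalk (h : IsParallelVia G₁ G₂ G f₁ f₂ φ)
    (h₁ : G₁.HasProperTerminals) (h₂ : G₂.HasProperTerminals) {a : G₁.V} (ha : a ≠ G₁.s)
    {p : List G.E} (hp : G.IsWalk (f₁ a) p G.t) :
    ∃ p₁ : List G₁.E, p = p₁.map fun e => φ (.inl e) := by
  induction p generalizing a with
  | nil => exact ⟨[], rfl⟩
  | cons e p ih =>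
    obtain ⟨he, hp⟩ := hp
    obtain ⟨e | e, rfl⟩ := φ.surjective e
    · rw [h.gluing.tgt_left] at hp
      obtain ⟨p₁, rfl⟩ := ih (h₁.tgt_ne_s e) hp
      exact ⟨e :: p₁, rfl⟩
    · rw [h.gluing.src_right, eq_comm, h.gluing.eq_iff] at he
      rcases he with ⟨hs, -⟩ | ⟨-, ht⟩
      exacts [(ha hs).elim, (h₂.src_ne_t e ht).elim]

theorem exists_eq_map_of_isSTPath (h : IsParallelVia G₁ G₂ G f₁ f₂ φ)
    (h₁ : G₁.HasProperTerminals) (h₂ : G₂.HasProperTerminals)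
    {p : List G.E} (hp : G.IsSTPath p) :
    (∃ p₁, G₁.IsSTPath p₁ ∧ (p₁.map fun e => φ (.inl e)) = p) ∨
      ∃ p₂, G₂.IsSTPath p₂ ∧ (p₂.map fun e => φ (.inr e)) = p := by
  match p, hp with
  | [], hp => exact ((h.hasProperTerminals h₁ h₂).s_ne_t hp.1).elim
  | e :: p, hp =>
    have hw := hp.1.2
    obtain ⟨e | e, rfl⟩ := φ.surjective e
    · rw [h.gluing.tgt_left] at hw
      obtain ⟨p₁, rfl⟩ := h.exists_eq_map_left_of_isWalk h₁ h₂ (h₁.tgt_ne_s e) hw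
      exact .inl ⟨e :: p₁, h.isSTPath_map_left.1 hp, rfl⟩
    · rw [h.gluing.tgt_right] at hw
      obtain ⟨p₂, rfl⟩ := h.symm.exists_eq_map_left_of_isWalk h₂ h₁ (h₂.tgt_ne_s e) hw
      exact .inr ⟨e :: p₂, h.isSTPath_map_right.1 hp, rfl⟩

variable {Y : Type*} [AddCommMonoid Y]

theorem isFlow_left (h : IsParallelVia G₁ G₂ G f₁ f₂ φ) {X : G.E → Y} (hX : G.IsFlow X) :
    G₁.IsFlow fun e => X (φ (.inl e)) := by
  refine h.gluing.isFlow_left hX fun a hs ht => ⟨by simp [hs, ht], ?_, ?_⟩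
  · rwa [h.s_eq, h.gluing.injective_left.ne_iff]
  · rwa [h.t_eq, h.gluing.injective_left.ne_iff]

theorem isFlow_right (h : IsParallelVia G₁ G₂ G f₁ f₂ φ) {X : G.E → Y} (hX : G.IsFlow X) :
    G₂.IsFlow fun e => X (φ (.inr e)) :=
  h.symm.isFlow_left hX

theorem flowValue_eq (h : IsParallelVia G₁ G₂ G f₁ f₂ φ) (X : G.E → Y) :
    G.flowValue X =
      G₁.flowValue (fun e => X (φ (.inl e))) + G₂.flowValue (fun e => X (φ (.inr e))) := by
  have := h.gluing.outflow_glued X (a := G₁.s) (b := G₂.s) (by simp)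
  rwa [← h.s_eq] at this

theorem inflow_t_eq (h : IsParallelVia G₁ G₂ G f₁ f₂ φ) (X : G.E → Y) :
    G.inflow X G.t = G₁.inflow (fun e => X (φ (.inl e))) G₁.t +
      G₂.inflow (fun e => X (φ (.inr e))) G₂.t := by
  have := h.gluing.inflow_glued X (a := G₁.t) (b := G₂.t) (by simp)
  rwa [← h.t_eq] at this

end IsParallelVia

end Parallel

section Series

variable {G₁ G₂ G : STGraph.{u, v}} {f₁ : G₁.V → G.V} {f₂ : G₂.V → G.V}
  {φ : G₁.E ⊕ G₂.E ≃ G.E}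

/-- The maps `f₁`, `f₂`, `φ` exhibit `G` as the series composition of `G₁` and `G₂`. -/
structure IsSeriesVia (G₁ G₂ G : STGraph.{u, v}) (f₁ : G₁.V → G.V) (f₂ : G₂.V → G.V)
    (φ : G₁.E ⊕ G₂.E ≃ G.E) : Prop where
  gluing : IsGluing G₁ G₂ G (fun a b => a = G₁.t ∧ b = G₂.s) f₁ f₂ φ
  s_eq : G.s = f₁ G₁.s
  t_eq : G.t = f₂ G₂.t

namespace IsSeriesVia

theorem t_eq_s (h : IsSeriesVia G₁ G₂ G f₁ f₂ φ) : f₁ G₁.t = f₂ G₂.s := by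
  rw [h.gluing.eq_iff]; simp

theorem hasProperTerminals (h : IsSeriesVia G₁ G₂ G f₁ f₂ φ) (h₁ : G₁.HasProperTerminals)
    (h₂ : G₂.HasProperTerminals) : G.HasProperTerminals where
  s_ne_t := by
    rw [h.s_eq, h.t_eq, Ne, h.gluing.eq_iff]
    exact fun hs => h₁.s_ne_t hs.1
  tgt_ne_s e := by
    obtain ⟨e | e, rfl⟩ := φ.surjective e
    · rw [h.gluing.tgt_left, h.s_eq, h.gluing.injective_left.ne_iff]
      exact h₁.tgt_ne_s e
    · rw [h.gluing.tgt_right, h.s_eq, ne_comm, Ne, h.gluing.eq_iff]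
      exact fun hs => h₁.s_ne_t hs.1
  src_ne_t e := by
    obtain ⟨e | e, rfl⟩ := φ.surjective e
    · rw [h.gluing.src_left, h.t_eq, Ne, h.gluing.eq_iff]
      exact fun hs => h₂.s_ne_t hs.2.symm
    · rw [h.gluing.src_right, h.t_eq, h.gluing.injective_right.ne_iff]
      exact h₂.src_ne_t e

/-- The only common vertex of the parts is the glued one, and the second path does not come back to
it because no edge enters the source of `G₂`. -/
theorem isSTPath_append (h : IsSeriesVia G₁ G₂ G f₁ f₂ φ) (h₂ : G₂.HasProperTerminals)
    {p₁ : List G₁.E} {p₂ : List G₂.E} (hp₁ : G₁.IsSTPath p₁) (hp₂ : G₂.IsSTPath p₂) :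
    G.IsSTPath ((p₁.map fun e => φ (.inl e)) ++ p₂.map fun e => φ (.inr e)) := by
  refine ⟨isWalk_append.2 ⟨f₁ G₁.t, ?_, ?_⟩, ?_⟩
  · rw [h.s_eq]
    exact h.gluing.isWalk_map_left.2 hp₁.1
  · rw [h.t_eq_s, h.t_eq]
    exact h.gluing.symm.isWalk_map_left.2 hp₂.1
  · rw [List.map_append, h.gluing.map_tgt_left, h.gluing.map_tgt_right, h.s_eq,
      ← List.cons_append, ← List.map_cons]
    refine (hp₁.2.map h.gluing.injective_left).append
      (hp₂.2.of_cons.map h.gluing.injective_right) fun c hc₁ hc₂ => ?_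
    obtain ⟨a, -, rfl⟩ := List.mem_map.1 hc₁
    obtain ⟨b, hb, hab⟩ := List.mem_map.1 hc₂
    obtain ⟨e, -, rfl⟩ := List.mem_map.1 hb
    exact h₂.tgt_ne_s e ((h.gluing.eq_iff _ _).1 hab.symm).2

theorem exists_eq_map_right_of_isWalk (h : IsSeriesVia G₁ G₂ G f₁ f₂ φ)
    (h₁ : G₁.HasProperTerminals) {b : G₂.V} {p : List G.E} (hp : G.IsWalk (f₂ b) p G.t) :
    ∃ p₂ : List G₂.E, p = p₂.map fun e => φ (.inr e) := by
  induction p generalizing b with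
  | nil => exact ⟨[], rfl⟩
  | cons e p ih =>
    obtain ⟨he, hp⟩ := hp
    obtain ⟨e | e, rfl⟩ := φ.surjective e
    · rw [h.gluing.src_left, h.gluing.eq_iff] at he
      exact (h₁.src_ne_t e he.1).elim
    · rw [h.gluing.tgt_right] at hp
      obtain ⟨p₂, rfl⟩ := ih hp
      exact ⟨e :: p₂, rfl⟩

theorem exists_eq_append_of_isWalk (h : IsSeriesVia G₁ G₂ G f₁ f₂ φ)
    (h₁ : G₁.HasProperTerminals) (h₂ : G₂.HasProperTerminals) {a : G₁.V} {p : List G.E}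
    (hp : G.IsWalk (f₁ a) p G.t) :
    ∃ p₁ p₂, G₁.IsWalk a p₁ G₁.t ∧ G₂.IsWalk G₂.s p₂ G₂.t ∧
      p = (p₁.map fun e => φ (.inl e)) ++ p₂.map fun e => φ (.inr e) := by
  induction p generalizing a with
  | nil =>
    have hp : f₁ a = G.t := hp
    rw [h.t_eq, h.gluing.eq_iff] at hp
    exact (h₂.s_ne_t hp.2.symm).elim
  | cons e p ih =>
    obtain ⟨e | e, rfl⟩ := φ.surjective e
    · obtain ⟨he, hp⟩ := hp
      rw [h.gluing.src_left, h.gluing.injective_left.eq_iff] at he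
      rw [h.gluing.tgt_left] at hp
      obtain ⟨p₁, p₂, hp₁, hp₂, rfl⟩ := ih hp
      exact ⟨e :: p₁, p₂, ⟨he, hp₁⟩, hp₂, rfl⟩
    · have he := hp.1
      rw [h.gluing.src_right, eq_comm, h.gluing.eq_iff] at he
      obtain ⟨rfl, -⟩ := he
      rw [h.t_eq_s] at hp
      obtain ⟨p₂, hp₂⟩ := h.exists_eq_map_right_of_isWalk h₁ hp
      rw [hp₂, h.t_eq] at hp
      exact ⟨[], p₂, rfl, h.gluing.symm.isWalk_map_left.1 hp, hp₂⟩

theorem exists_eq_append_of_isSTPath (h : IsSeriesVia G₁ G₂ G f₁ f₂ φ)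
    (h₁ : G₁.HasProperTerminals) (h₂ : G₂.HasProperTerminals) {p : List G.E}
    (hp : G.IsSTPath p) :
    ∃ p₁ p₂, G₁.IsSTPath p₁ ∧ G₂.IsSTPath p₂ ∧
      ((p₁.map fun e => φ (.inl e)) ++ p₂.map fun e => φ (.inr e)) = p := by
  have hw := hp.1
  rw [h.s_eq] at hw
  obtain ⟨p₁, p₂, hw₁, hw₂, rfl⟩ := h.exists_eq_append_of_isWalk h₁ h₂ hw
  have hn := hp.2
  rw [List.map_append, h.gluing.map_tgt_left, h.gluing.map_tgt_right, h.s_eq,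
    ← List.cons_append, ← List.map_cons] at hn
  refine ⟨p₁, p₂, ⟨hw₁, hn.of_append_left.of_map⟩, ⟨hw₂, ?_⟩, rfl⟩
  refine List.nodup_cons.2 ⟨fun hs => ?_, hn.of_append_right.of_map⟩
  obtain ⟨e, -, he⟩ := List.mem_map.1 hs
  exact h₂.tgt_ne_s e he

variable {Y : Type*} [AddCommMonoid Y]

theorem isFlow_left (h : IsSeriesVia G₁ G₂ G f₁ f₂ φ) {X : G.E → Y} (hX : G.IsFlow X) :
    G₁.IsFlow fun e => X (φ (.inl e)) := by
  refine h.gluing.isFlow_left hX fun a hs ht => ⟨by simp [ht], ?_, ?_⟩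
  · rwa [h.s_eq, h.gluing.injective_left.ne_iff]
  · rw [h.t_eq, Ne, h.gluing.eq_iff]
    exact fun hab => ht hab.1

theorem isFlow_right (h : IsSeriesVia G₁ G₂ G f₁ f₂ φ) {X : G.E → Y} (hX : G.IsFlow X) :
    G₂.IsFlow fun e => X (φ (.inr e)) := by
  refine h.gluing.symm.isFlow_left hX fun b hs ht => ⟨by simp [hs], ?_, ?_⟩
  · rw [h.s_eq, ne_comm, Ne, h.gluing.eq_iff]
    exact fun hab => hs hab.2
  · rwa [h.t_eq, h.gluing.injective_right.ne_iff]

theorem flowValue_eq_left (h : IsSeriesVia G₁ G₂ G f₁ f₂ φ) (h₁ : G₁.HasProperTerminals)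
    (X : G.E → Y) : G.flowValue X = G₁.flowValue (fun e => X (φ (.inl e))) := by
  have := h.gluing.outflow_left X (a := G₁.s) (by simp [h₁.s_ne_t])
  rwa [← h.s_eq] at this

theorem inflow_t_eq (h : IsSeriesVia G₁ G₂ G f₁ f₂ φ) (h₂ : G₂.HasProperTerminals)
    (X : G.E → Y) : G.inflow X G.t = G₂.inflow (fun e => X (φ (.inr e))) G₂.t := by
  have := h.gluing.symm.inflow_left X (a := G₂.t) (by simp [h₂.s_ne_t.symm])
  rwa [← h.t_eq] at this

/-- This is conservation at the glued vertex, which only edges of `G₁` enter and only edges of `G₂`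
leave. -/
theorem inflow_left_t_eq (h : IsSeriesVia G₁ G₂ G f₁ f₂ φ) (h₁ : G₁.HasProperTerminals)
    (h₂ : G₂.HasProperTerminals) {X : G.E → Y} (hX : G.IsFlow X) :
    G₁.inflow (fun e => X (φ (.inl e))) G₁.t = G₂.flowValue fun e => X (φ (.inr e)) := by
  have hc : G.inflow X (f₁ G₁.t) = G.outflow X (f₁ G₁.t) := by
    refine hX.inflow_eq_outflow ?_ ?_
    · rw [h.s_eq, h.gluing.injective_left.ne_iff]
      exact h₁.s_ne_t.symm
    · rw [h.t_eq_s, h.t_eq, h.gluing.injective_right.ne_iff]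
      exact h₂.s_ne_t
  rw [h.gluing.inflow_glued X ⟨rfl, rfl⟩, h.gluing.outflow_glued X ⟨rfl, rfl⟩,
    inflow_eq_zero _ h₂.tgt_ne_s, outflow_eq_zero _ h₁.src_ne_t, add_zero, zero_add] at hc
  exact hc

end IsSeriesVia

end Series

/-! ### Flows on series-parallel graphs -/

theorem IsSingleEdge.hasProperTerminals {G : STGraph.{u, v}} (h : G.IsSingleEdge) :
    G.HasProperTerminals := by
  obtain ⟨hst, -, e, he, hs, ht⟩ := h
  refine ⟨hst, fun e' => ?_, fun e' => ?_⟩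
  · rw [he e', ht]
    exact hst.symm
  · rw [he e', hs]
    exact hst

theorem IsParallelComposition.exists_via {G₁ G₂ G : STGraph.{u, v}}
    (h : IsParallelComposition G₁ G₂ G) : ∃ f₁ f₂ φ, IsParallelVia G₁ G₂ G f₁ f₂ φ := by
  obtain ⟨f₁, f₂, φ, hg, hs, ht⟩ := h
  exact ⟨f₁, f₂, φ, hg, hs, ht⟩

theorem IsSeriesComposition.exists_via {G₁ G₂ G : STGraph.{u, v}}
    (h : IsSeriesComposition G₁ G₂ G) : ∃ f₁ f₂ φ, IsSeriesVia G₁ G₂ G f₁ f₂ φ := by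
  obtain ⟨f₁, f₂, φ, hg, hs, ht⟩ := h
  exact ⟨f₁, f₂, φ, hg, hs, ht⟩

namespace IsSeriesParallel

theorem hasProperTerminals {G : STGraph.{u, v}} (h : G.IsSeriesParallel) :
    G.HasProperTerminals := by
  induction h with
  | single h => exact h.hasProperTerminals
  | parallel _ _ h ih₁ ih₂ =>
    obtain ⟨f₁, f₂, φ, h⟩ := h.exists_via
    exact h.hasProperTerminals ih₁ ih₂
  | series _ _ h ih₁ ih₂ =>
    obtain ⟨f₁, f₂, φ, h⟩ := h.exists_via
    exact h.hasProperTerminals ih₁ ih₂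

/-- Structural induction replaces the usual summation over all vertices, so no cancellation in `Y`
is needed and the result applies to `ℕ` and `ℝ` alike. -/
theorem inflow_t_eq_flowValue {Y : Type*} [AddCommMonoid Y] {G : STGraph.{u, v}}
    (h : G.IsSeriesParallel) {X : G.E → Y} (hX : G.IsFlow X) :
    G.inflow X G.t = G.flowValue X := by
  induction h with
  | @single G h =>
    obtain ⟨-, -, e, he, hs, ht⟩ := h
    have hs' (e') : G.src e' = G.s := by rw [he e', hs]
    have ht' (e') : G.tgt e' = G.t := by rw [he e', ht]
    simp [inflow, flowValue, hs', ht']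
  | parallel _ _ h ih₁ ih₂ =>
    obtain ⟨f₁, f₂, φ, h⟩ := h.exists_via
    rw [h.inflow_t_eq, h.flowValue_eq, ih₁ (h.isFlow_left hX), ih₂ (h.isFlow_right hX)]
  | series h₁ h₂ h ih₁ ih₂ =>
    obtain ⟨f₁, f₂, φ, h⟩ := h.exists_via
    rw [h.inflow_t_eq h₂.hasProperTerminals, ih₂ (h.isFlow_right hX),
      ← h.inflow_left_t_eq h₁.hasProperTerminals h₂.hasProperTerminals hX,
      ih₁ (h.isFlow_left hX), h.flowValue_eq_left h₁.hasProperTerminals]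

end IsSeriesParallel

theorem IsSeriesVia.flowValue_eq_right {Y : Type*} [AddCommMonoid Y] {G₁ G₂ G : STGraph.{u, v}}
    {f₁ : G₁.V → G.V} {f₂ : G₂.V → G.V} {φ : G₁.E ⊕ G₂.E ≃ G.E}
    (h : IsSeriesVia G₁ G₂ G f₁ f₂ φ) (h₁ : G₁.IsSeriesParallel) (h₂ : G₂.IsSeriesParallel)
    {X : G.E → Y} (hX : G.IsFlow X) :
    G.flowValue X = G₂.flowValue fun e => X (φ (.inr e)) := by
  rw [h.flowValue_eq_left h₁.hasProperTerminals, ← h₁.inflow_t_eq_flowValue (h.isFlow_left hX),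
    h.inflow_left_t_eq h₁.hasProperTerminals h₂.hasProperTerminals hX]

namespace IsSeriesParallel

/-- Excludes circulations. It is also the reason why a nonzero flow on a series composition is
nonzero on both parts. -/
theorem eq_zero_of_flowValue_eq_zero {Y : Type*} [AddCommMonoid Y] [PartialOrder Y]
    [IsOrderedAddMonoid Y] {G : STGraph.{u, v}}
    (h : G.IsSeriesParallel) {X : G.E → Y} (hX : G.IsFlow X) (hX₀ : 0 ≤ X)
    (hv : G.flowValue X = 0) : X = 0 := by
  induction h with
  | @single G h =>
    obtain ⟨-, -, e, he, hs, ht⟩ := h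
    have hs' (e') : G.src e' = G.s := by rw [he e', hs]
    rw [flowValue, Finset.sum_eq_zero_iff_of_nonneg fun e _ => hX₀ e] at hv
    exact funext fun e => hv e (by simp [hs'])
  | parallel _ _ h ih₁ ih₂ =>
    obtain ⟨f₁, f₂, φ, h⟩ := h.exists_via
    rw [h.flowValue_eq] at hv
    have hl : 0 ≤ fun e => X (φ (.inl e)) := fun e => hX₀ _
    have hr : 0 ≤ fun e => X (φ (.inr e)) := fun e => hX₀ _
    rw [add_eq_zero_iff_of_nonneg (flowValue_nonneg hl) (flowValue_nonneg hr)] at hv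
    have h₁ := ih₁ (h.isFlow_left hX) hl hv.1
    have h₂ := ih₂ (h.isFlow_right hX) hr hv.2
    funext e
    obtain ⟨e | e, rfl⟩ := φ.surjective e
    exacts [congrFun h₁ e, congrFun h₂ e]
  | series h₁ h₂ h ih₁ ih₂ =>
    obtain ⟨f₁, f₂, φ, h⟩ := h.exists_via
    have hl := ih₁ (h.isFlow_left hX) (fun e => hX₀ _)
      (by rwa [← h.flowValue_eq_left h₁.hasProperTerminals])
    have hr := ih₂ (h.isFlow_right hX) (fun e => hX₀ _)
      (by rwa [← h.flowValue_eq_right h₁ h₂ hX])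
    funext e
    obtain ⟨e | e, rfl⟩ := φ.surjective e
    exacts [congrFun hl e, congrFun hr e]

theorem exists_isSTPath {G : STGraph.{u, v}} (h : G.IsSeriesParallel) :
    ∃ p, G.IsSTPath p := by
  induction h with
  | single h =>
    obtain ⟨hst, -, e, -, hs, ht⟩ := h
    exact ⟨[e], ⟨hs, ht⟩, by simp [ht, hst]⟩
  | parallel _ _ h ih₁ ih₂ =>
    obtain ⟨f₁, f₂, φ, h⟩ := h.exists_via
    obtain ⟨p, hp⟩ := ih₁
    exact ⟨_, h.isSTPath_map_left.2 hp⟩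
  | series h₁ h₂ h ih₁ ih₂ =>
    obtain ⟨f₁, f₂, φ, h⟩ := h.exists_via
    obtain ⟨p₁, hp₁⟩ := ih₁
    obtain ⟨p₂, hp₂⟩ := ih₂
    exact ⟨_, h.isSTPath_append h₂.hasProperTerminals hp₁ hp₂⟩

theorem exists_isSTPath_of_ne_zero {Y : Type*} [AddCommMonoid Y] [PartialOrder Y]
    [IsOrderedAddMonoid Y] {G : STGraph.{u, v}} (h : G.IsSeriesParallel) {X : G.E → Y}
    (hX : G.IsFlow X) (hX₀ : 0 ≤ X) (hne : X ≠ 0) : ∃ p, G.IsSTPath p ∧ ∀ e ∈ p, X e ≠ 0 := by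
  induction h with
  | single h =>
    obtain ⟨hst, -, e, he, hs, ht⟩ := h
    obtain ⟨e', he'⟩ := Function.ne_iff.1 hne
    rw [he e'] at he'
    exact ⟨[e], ⟨⟨hs, ht⟩, by simp [ht, hst]⟩, by simpa using he'⟩
  | parallel _ _ h ih₁ ih₂ =>
    obtain ⟨f₁, f₂, φ, h⟩ := h.exists_via
    obtain ⟨e, he⟩ := Function.ne_iff.1 hne
    obtain ⟨e | e, rfl⟩ := φ.surjective e
    · obtain ⟨p, hp, hpX⟩ := ih₁ (h.isFlow_left hX) (fun e => hX₀ _)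
        (Function.ne_iff.2 ⟨e, he⟩)
      exact ⟨_, h.isSTPath_map_left.2 hp, by simpa using hpX⟩
    · obtain ⟨p, hp, hpX⟩ := ih₂ (h.isFlow_right hX) (fun e => hX₀ _)
        (Function.ne_iff.2 ⟨e, he⟩)
      exact ⟨_, h.isSTPath_map_right.2 hp, by simpa using hpX⟩
  | series h₁ h₂ h ih₁ ih₂ =>
    have hG := series h₁ h₂ h
    obtain ⟨f₁, f₂, φ, h⟩ := h.exists_via
    have hv := mt (hG.eq_zero_of_flowValue_eq_zero hX hX₀) hne
    obtain ⟨p₁, hp₁, hX₁⟩ := ih₁ (h.isFlow_left hX) (fun e => hX₀ _) fun h0 => hv <| by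
      rw [h.flowValue_eq_left h₁.hasProperTerminals, h0, flowValue_zero]
    obtain ⟨p₂, hp₂, hX₂⟩ := ih₂ (h.isFlow_right hX) (fun e => hX₀ _) fun h0 => hv <| by
      rw [h.flowValue_eq_right h₁ h₂ hX, h0, flowValue_zero]
    refine ⟨_, h.isSTPath_append h₂.hasProperTerminals hp₁ hp₂, fun e he => ?_⟩
    rcases List.mem_append.1 he with he | he <;> obtain ⟨e, he', rfl⟩ := List.mem_map.1 he
    exacts [hX₁ e he', hX₂ e he']

end IsSeriesParallel

/-! ### Lists -/

/-- Serves to sort the paths of a cover of a parallel composition by the part they lie in. -/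
theorem exists_perm_map_append_map {α β γ : Type*} {g₁ : β → α} {g₂ : γ → α} {Q₁ : β → Prop}
    {Q₂ : γ → Prop} {l : List α}
    (h : ∀ a ∈ l, (∃ b, Q₁ b ∧ g₁ b = a) ∨ ∃ c, Q₂ c ∧ g₂ c = a) :
    ∃ (l₁ : List β) (l₂ : List γ), (∀ b ∈ l₁, Q₁ b) ∧ (∀ c ∈ l₂, Q₂ c) ∧
      l.Perm (l₁.map g₁ ++ l₂.map g₂) := by
  induction l with
  | nil => exact ⟨[], [], by simp⟩
  | cons a l ih =>
    obtain ⟨l₁, l₂, h₁, h₂, hl⟩ := ih fun a ha => h a (List.mem_cons_of_mem _ ha)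
    rcases h a List.mem_cons_self with ⟨b, hb, rfl⟩ | ⟨c, hc, rfl⟩
    · exact ⟨b :: l₁, l₂, List.forall_mem_cons.2 ⟨hb, h₁⟩, h₂, by simpa using hl⟩
    · exact ⟨l₁, c :: l₂, h₁, List.forall_mem_cons.2 ⟨hc, h₂⟩,
        (hl.cons _).trans (by simpa using List.perm_middle.symm)⟩

theorem exists_map_eq {α β : Type*} {g : β → α} {Q : β → Prop} {l : List α}
    (h : ∀ a ∈ l, ∃ b, Q b ∧ g b = a) : ∃ l' : List β, (∀ b ∈ l', Q b) ∧ l'.map g = l := by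
  induction l with
  | nil => exact ⟨[], by simp⟩
  | cons a l ih =>
    obtain ⟨l', h', rfl⟩ := ih fun a ha => h a (List.mem_cons_of_mem _ ha)
    obtain ⟨b, hb, rfl⟩ := h a List.mem_cons_self
    exact ⟨b :: l', List.forall_mem_cons.2 ⟨hb, h'⟩, rfl⟩

/-- Two nonempty lists are, as sets, the projections of a list of pairs that is as long as the
longer one of them. -/
theorem exists_list_prod {α β : Type*} : ∀ {l₁ : List α} {l₂ : List β}, l₁ ≠ [] → l₂ ≠ [] →
    ∃ l : List (α × β), l.length = max l₁.length l₂.length ∧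
      (∀ a, a ∈ l.map Prod.fst ↔ a ∈ l₁) ∧ ∀ b, b ∈ l.map Prod.snd ↔ b ∈ l₂
  | [a], l₂, _, h₂ => by
    have := List.length_pos_iff.2 h₂
    obtain ⟨b, hb⟩ := List.exists_mem_of_ne_nil l₂ h₂
    refine ⟨l₂.map fun b => (a, b), ?_, fun x => ?_, by simp⟩
    · simp only [List.length_map, List.length_singleton]
      omega
    · simp only [List.map_map, List.mem_map, List.mem_singleton, Function.comp]
      exact ⟨fun ⟨_, _, h⟩ => h.symm, fun h => ⟨b, hb, h.symm⟩⟩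
  | a :: a' :: l₁, [b], _, _ =>
    ⟨(a :: a' :: l₁).map fun a => (a, b), by simp, by simp, fun x => by
      simp only [List.map_cons, List.map_map, List.mem_cons, List.mem_map, Function.comp,
        List.not_mem_nil, or_false]
      exact ⟨fun h => by aesop, fun h => .inl h⟩⟩
  | a :: a' :: l₁, b :: b' :: l₂, _, _ => by
    obtain ⟨l, hl, h₁, h₂⟩ :=
      exists_list_prod (List.cons_ne_nil a' l₁) (List.cons_ne_nil b' l₂)
    refine ⟨(a, b) :: l, ?_, fun x => ?_, fun x => ?_⟩
    · simp only [List.length_cons, hl]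
      omega
    · rw [List.map_cons, List.mem_cons, h₁, List.mem_cons (b := a)]
    · rw [List.map_cons, List.mem_cons, h₂, List.mem_cons (b := b)]

/-! ### Path covers of edge sets -/

/-- The family `P` consists of `s`-`t` paths whose edges together are exactly those in `S`. -/
structure Covers (G : STGraph.{u, v}) (P : List (List G.E)) (S : Set G.E) : Prop where
  isSTPath : ∀ p ∈ P, G.IsSTPath p
  mem_of_mem : ∀ p ∈ P, ∀ e ∈ p, e ∈ S
  exists_mem : ∀ e ∈ S, ∃ p ∈ P, e ∈ p

theorem Covers.of_mem_iff {G : STGraph.{u, v}} {P P' : List (List G.E)} {S : Set G.E}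
    (h : G.Covers P S) (hP : ∀ p, p ∈ P ↔ p ∈ P') : G.Covers P' S where
  isSTPath p hp := h.isSTPath p ((hP p).2 hp)
  mem_of_mem p hp := h.mem_of_mem p ((hP p).2 hp)
  exists_mem e he := by simpa [hP] using h.exists_mem e he

theorem covers_nil {G : STGraph.{u, v}} : G.Covers [] ∅ where
  isSTPath := by simp
  mem_of_mem := by simp
  exists_mem := by simp

theorem Covers.ne_nil {G : STGraph.{u, v}} {P : List (List G.E)} {S : Set G.E}
    (h : G.Covers P S) (hS : S.Nonempty) : P ≠ [] := by
  rintro rfl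
  obtain ⟨e, he⟩ := hS
  simpa using h.exists_mem e he

section Gluing

variable {G₁ G₂ G : STGraph.{u, v}} {f₁ : G₁.V → G.V} {f₂ : G₂.V → G.V}
  {φ : G₁.E ⊕ G₂.E ≃ G.E} {S : Set G.E}

theorem IsParallelVia.exists_covers (h : IsParallelVia G₁ G₂ G f₁ f₂ φ)
    (h₁ : G₁.HasProperTerminals) (h₂ : G₂.HasProperTerminals) {P : List (List G.E)}
    (hP : G.Covers P S) :
    ∃ P₁ P₂, G₁.Covers P₁ {e | φ (.inl e) ∈ S} ∧ G₂.Covers P₂ {e | φ (.inr e) ∈ S} ∧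
      P₁.length + P₂.length = P.length := by
  obtain ⟨P₁, P₂, hP₁, hP₂, hperm⟩ := exists_perm_map_append_map fun p hp =>
    h.exists_eq_map_of_isSTPath h₁ h₂ (hP.isSTPath p hp)
  have hP' := hP.of_mem_iff fun p => hperm.mem_iff
  refine ⟨P₁, P₂, ⟨hP₁, fun p hp e he => ?_, fun e he => ?_⟩,
    ⟨hP₂, fun p hp e he => ?_, fun e he => ?_⟩, by simpa using hperm.length_eq.symm⟩
  · exact hP'.mem_of_mem _ (List.mem_append_left _ (List.mem_map_of_mem hp)) _
      (List.mem_map_of_mem he)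
  · obtain ⟨_, hp, hep⟩ := hP'.exists_mem _ he
    rcases List.mem_append.1 hp with hp | hp <;> obtain ⟨p, hp', rfl⟩ := List.mem_map.1 hp
    · exact ⟨p, hp', by simpa using hep⟩
    · simp at hep
  · exact hP'.mem_of_mem _ (List.mem_append_right _ (List.mem_map_of_mem hp)) _
      (List.mem_map_of_mem he)
  · obtain ⟨_, hp, hep⟩ := hP'.exists_mem _ he
    rcases List.mem_append.1 hp with hp | hp <;> obtain ⟨p, hp', rfl⟩ := List.mem_map.1 hp
    · simp at hep
    · exact ⟨p, hp', by simpa using hep⟩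

theorem IsParallelVia.covers_append (h : IsParallelVia G₁ G₂ G f₁ f₂ φ)
    {P₁ : List (List G₁.E)} {P₂ : List (List G₂.E)}
    (hP₁ : G₁.Covers P₁ {e | φ (.inl e) ∈ S}) (hP₂ : G₂.Covers P₂ {e | φ (.inr e) ∈ S}) :
    G.Covers (P₁.map (List.map fun e => φ (.inl e)) ++ P₂.map (List.map fun e => φ (.inr e)))
      S where
  isSTPath p hp := by
    rcases List.mem_append.1 hp with hp | hp <;> obtain ⟨p, hp', rfl⟩ := List.mem_map.1 hp
    exacts [h.isSTPath_map_left.2 (hP₁.isSTPath p hp'),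
      h.isSTPath_map_right.2 (hP₂.isSTPath p hp')]
  mem_of_mem p hp e he := by
    rcases List.mem_append.1 hp with hp | hp <;> obtain ⟨p, hp', rfl⟩ := List.mem_map.1 hp <;>
      obtain ⟨e, he', rfl⟩ := List.mem_map.1 he
    exacts [hP₁.mem_of_mem p hp' e he', hP₂.mem_of_mem p hp' e he']
  exists_mem e he := by
    obtain ⟨e | e, rfl⟩ := φ.surjective e
    · obtain ⟨p, hp, hep⟩ := hP₁.exists_mem e he
      exact ⟨_, List.mem_append_left _ (List.mem_map_of_mem hp), List.mem_map_of_mem hep⟩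
    · obtain ⟨p, hp, hep⟩ := hP₂.exists_mem e he
      exact ⟨_, List.mem_append_right _ (List.mem_map_of_mem hp), List.mem_map_of_mem hep⟩

theorem IsSeriesVia.exists_covers (h : IsSeriesVia G₁ G₂ G f₁ f₂ φ)
    (h₁ : G₁.HasProperTerminals) (h₂ : G₂.HasProperTerminals) {P : List (List G.E)}
    (hP : G.Covers P S) :
    ∃ P₁ P₂, G₁.Covers P₁ {e | φ (.inl e) ∈ S} ∧ G₂.Covers P₂ {e | φ (.inr e) ∈ S} ∧
      P₁.length = P.length ∧ P₂.length = P.length := by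
  obtain ⟨Q, hQ, rfl⟩ := exists_map_eq (β := List G₁.E × List G₂.E)
    (Q := fun q => G₁.IsSTPath q.1 ∧ G₂.IsSTPath q.2)
    (g := fun q => (q.1.map fun e => φ (.inl e)) ++ q.2.map fun e => φ (.inr e))
    fun p hp => by
      obtain ⟨p₁, p₂, hp₁, hp₂, h⟩ := h.exists_eq_append_of_isSTPath h₁ h₂ (hP.isSTPath p hp)
      exact ⟨(p₁, p₂), ⟨hp₁, hp₂⟩, h⟩
  refine ⟨Q.map Prod.fst, Q.map Prod.snd, ⟨?_, ?_, fun e he => ?_⟩,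
    ⟨?_, ?_, fun e he => ?_⟩, by simp, by simp⟩
  · exact List.forall_mem_map.2 fun q hq => (hQ q hq).1
  · exact List.forall_mem_map.2 fun q hq e he => hP.mem_of_mem _ (List.mem_map_of_mem hq) _
      (List.mem_append_left _ (List.mem_map_of_mem he))
  · obtain ⟨_, hp, hep⟩ := hP.exists_mem _ he
    obtain ⟨q, hq, rfl⟩ := List.mem_map.1 hp
    exact ⟨q.1, List.mem_map_of_mem hq, by simpa using hep⟩
  · exact List.forall_mem_map.2 fun q hq => (hQ q hq).2
  · exact List.forall_mem_map.2 fun q hq e he => hP.mem_of_mem _ (List.mem_map_of_mem hq) _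
      (List.mem_append_right _ (List.mem_map_of_mem he))
  · obtain ⟨_, hp, hep⟩ := hP.exists_mem _ he
    obtain ⟨q, hq, rfl⟩ := List.mem_map.1 hp
    exact ⟨q.2, List.mem_map_of_mem hq, by simpa using hep⟩

/-- Any path of the first part can be continued by any path of the second, so the two covers are
paired, with repetitions in the shorter one. -/
theorem IsSeriesVia.exists_covers_of_covers (h : IsSeriesVia G₁ G₂ G f₁ f₂ φ)
    (h₂ : G₂.HasProperTerminals) {P₁ : List (List G₁.E)} {P₂ : List (List G₂.E)}
    (hP₁ : G₁.Covers P₁ {e | φ (.inl e) ∈ S}) (hP₂ : G₂.Covers P₂ {e | φ (.inr e) ∈ S})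
    (hne₁ : P₁ ≠ []) (hne₂ : P₂ ≠ []) :
    ∃ P, G.Covers P S ∧ P.length = max P₁.length P₂.length := by
  obtain ⟨Q, hQ, hQ₁, hQ₂⟩ := exists_list_prod hne₁ hne₂
  have hl := hP₁.of_mem_iff fun p => (hQ₁ p).symm
  have hr := hP₂.of_mem_iff fun p => (hQ₂ p).symm
  refine ⟨Q.map fun q => (q.1.map fun e => φ (.inl e)) ++ q.2.map fun e => φ (.inr e),
    ⟨?_, ?_, fun e he => ?_⟩, by simpa using hQ⟩
  · exact List.forall_mem_map.2 fun q hq => h.isSTPath_append h₂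
      (hl.isSTPath _ (List.mem_map_of_mem hq)) (hr.isSTPath _ (List.mem_map_of_mem hq))
  · refine List.forall_mem_map.2 fun q hq e he => ?_
    rcases List.mem_append.1 he with he | he <;> obtain ⟨e, he', rfl⟩ := List.mem_map.1 he
    exacts [hl.mem_of_mem _ (List.mem_map_of_mem hq) e he',
      hr.mem_of_mem _ (List.mem_map_of_mem hq) e he']
  · obtain ⟨e | e, rfl⟩ := φ.surjective e
    · obtain ⟨_, hp, hep⟩ := hl.exists_mem e he
      obtain ⟨q, hq, rfl⟩ := List.mem_map.1 hp
      exact ⟨_, List.mem_map_of_mem hq, List.mem_append_left _ (List.mem_map_of_mem hep)⟩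
    · obtain ⟨_, hp, hep⟩ := hr.exists_mem e he
      obtain ⟨q, hq, rfl⟩ := List.mem_map.1 hp
      exact ⟨_, List.mem_map_of_mem hq, List.mem_append_right _ (List.mem_map_of_mem hep)⟩

end Gluing

/-! ### Width-stability -/

open Function in
/-- A path cover of a set that contains the support of a non-negative flow yields a path cover of
the support that is not larger. -/
theorem IsSeriesParallel.exists_covers_support {Y : Type*} [AddCommMonoid Y] [PartialOrder Y]
    [IsOrderedAddMonoid Y] {G : STGraph.{u, v}} (h : G.IsSeriesParallel) {X : G.E → Y}
    (hX : G.IsFlow X) (hX₀ : 0 ≤ X) {S : Set G.E} (hS : support X ⊆ S) {P : List (List G.E)}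
    (hP : G.Covers P S) : ∃ P', G.Covers P' (support X) ∧ P'.length ≤ P.length := by
  -- The zero flow needs no paths. With it set aside, the covers of both parts of a series
  -- composition are nonempty and can be paired.
  rcases eq_or_ne X 0 with rfl | hne
  · exact ⟨[], by simpa using covers_nil, Nat.zero_le _⟩
  induction h with
  | single h =>
    obtain ⟨-, -, e, he, -, -⟩ := h
    have hsup : S ⊆ support X := fun e₁ _ => by
      obtain ⟨e₂, he₂⟩ := Function.ne_iff.1 hne
      rwa [mem_support, he e₁, ← he e₂]
    exact ⟨P, hS.antisymm hsup ▸ hP, le_rfl⟩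
  | parallel h₁ h₂ h ih₁ ih₂ =>
    obtain ⟨f₁, f₂, φ, h⟩ := h.exists_via
    obtain ⟨P₁, P₂, hP₁, hP₂, hl⟩ :=
      h.exists_covers h₁.hasProperTerminals h₂.hasProperTerminals hP
    have hl : ∃ P', Covers _ P' (support fun e => X (φ (.inl e))) ∧ P'.length ≤ P₁.length := by
      -- In parallel, a nonzero flow may still vanish on one of the parts.
      by_cases h0 : (fun e => X (φ (.inl e))) = 0
      · rw [h0]
        exact ⟨[], by simpa using covers_nil, Nat.zero_le _⟩
      · exact ih₁ (h.isFlow_left hX) (fun e => hX₀ _) (fun e he => hS he) hP₁ h0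
    have hr : ∃ P', Covers _ P' (support fun e => X (φ (.inr e))) ∧ P'.length ≤ P₂.length := by
      by_cases h0 : (fun e => X (φ (.inr e))) = 0
      · rw [h0]
        exact ⟨[], by simpa using covers_nil, Nat.zero_le _⟩
      · exact ih₂ (h.isFlow_right hX) (fun e => hX₀ _) (fun e he => hS he) hP₂ h0
    obtain ⟨P₁', hP₁', hl₁⟩ := hl
    obtain ⟨P₂', hP₂', hl₂⟩ := hr
    refine ⟨_, h.covers_append hP₁' hP₂', ?_⟩
    simp only [List.length_append, List.length_map]
    omega
  | series h₁ h₂ h ih₁ ih₂ =>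
    have hG := series h₁ h₂ h
    obtain ⟨f₁, f₂, φ, h⟩ := h.exists_via
    obtain ⟨P₁, P₂, hP₁, hP₂, hl₁, hl₂⟩ :=
      h.exists_covers h₁.hasProperTerminals h₂.hasProperTerminals hP
    have hv := mt (hG.eq_zero_of_flowValue_eq_zero hX hX₀) hne
    have hne₁ : (fun e => X (φ (.inl e))) ≠ 0 := fun h0 => hv <| by
      rw [h.flowValue_eq_left h₁.hasProperTerminals, h0, flowValue_zero]
    have hne₂ : (fun e => X (φ (.inr e))) ≠ 0 := fun h0 => hv <| by
      rw [h.flowValue_eq_right h₁ h₂ hX, h0, flowValue_zero]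
    obtain ⟨P₁', hP₁', hl₁'⟩ :=
      ih₁ (h.isFlow_left hX) (fun e => hX₀ _) (fun e he => hS he) hP₁ hne₁
    obtain ⟨P₂', hP₂', hl₂'⟩ :=
      ih₂ (h.isFlow_right hX) (fun e => hX₀ _) (fun e he => hS he) hP₂ hne₂
    obtain ⟨P', hP', hl'⟩ := h.exists_covers_of_covers (S := support X)
      h₂.hasProperTerminals hP₁' hP₂'
      (hP₁'.ne_nil (support_nonempty_iff.2 hne₁)) (hP₂'.ne_nil (support_nonempty_iff.2 hne₂))
    exact ⟨P', hP', by omega⟩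

theorem isWalk_restrict {G : STGraph.{u, v}} {Y : Type*} [Zero Y] {X : G.E → Y} {a b : G.V}
    {p : List {e : G.E // X e ≠ 0}} :
    (G.restrict X).IsWalk a p b ↔ G.IsWalk a (p.map Subtype.val) b := by
  induction p generalizing a with
  | nil => rfl
  | cons e p ih => exact and_congr Iff.rfl ih

theorem isSTPath_restrict {G : STGraph.{u, v}} {Y : Type*} [Zero Y] {X : G.E → Y}
    {p : List {e : G.E // X e ≠ 0}} :
    (G.restrict X).IsSTPath p ↔ G.IsSTPath (p.map Subtype.val) := by
  refine and_congr isWalk_restrict ?_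
  rw [List.map_map]
  rfl

theorem isPathCover_restrict {G : STGraph.{u, v}} {Y : Type*} [Zero Y] {X : G.E → Y}
    {P : List (List {e : G.E // X e ≠ 0})} :
    (G.restrict X).IsPathCover P ↔
      G.Covers (P.map (List.map Subtype.val)) (Function.support X) := by
  constructor
  · rintro ⟨hP, hE⟩
    refine ⟨List.forall_mem_map.2 fun p hp => isSTPath_restrict.1 (hP p hp),
      List.forall_mem_map.2 fun p hp => List.forall_mem_map.2 fun e _ => e.2, fun e he => ?_⟩
    obtain ⟨p, hp, hep⟩ := hE ⟨e, he⟩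
    exact ⟨_, List.mem_map_of_mem hp, List.mem_map_of_mem hep⟩
  · rintro ⟨hP, -, hE⟩
    refine ⟨fun p hp => isSTPath_restrict.2 (hP _ (List.mem_map_of_mem hp)), fun e => ?_⟩
    obtain ⟨_, hp, hep⟩ := hE e.1 e.2
    obtain ⟨p, hp', rfl⟩ := List.mem_map.1 hp
    obtain ⟨e', he', hee'⟩ := List.mem_map.1 hep
    exact ⟨p, hp', Subtype.ext hee' ▸ he'⟩

/-- The paths of the cover stay inside the support, so they lift to the subtype of edges of
`G.restrict X`. -/
theorem Covers.exists_isPathCover {G : STGraph.{u, v}} {Y : Type*} [Zero Y] {X : G.E → Y}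
    {P : List (List G.E)} (hP : G.Covers P (Function.support X)) :
    ∃ P', (G.restrict X).IsPathCover P' ∧ P'.length = P.length := by
  obtain ⟨P', -, rfl⟩ := exists_map_eq (l := P)
    (g := List.map (Subtype.val : {e : G.E // X e ≠ 0} → G.E)) (Q := fun _ => True)
    fun p hp => ⟨p.attach.map fun e => ⟨e.1, hP.mem_of_mem p hp e.1 e.2⟩, trivial, by simp⟩
  exact ⟨P', isPathCover_restrict.2 hP, (List.length_map _).symm⟩

theorem IsSeriesParallel.widthStable {G : STGraph.{u, v}} (h : G.IsSeriesParallel) :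
    G.WidthStable := by
  intro X Y hX _ hX₀ hXY
  refine le_iInf₂ fun P hP => ?_
  have hS : Function.support X ⊆ Function.support Y := fun e he =>
    (((hX₀ e).lt_of_ne' he).trans_le (hXY e)).ne'
  obtain ⟨P', hP', hl⟩ := h.exists_covers_support hX hX₀ hS (isPathCover_restrict.1 hP)
  obtain ⟨P'', hP'', hl'⟩ := hP'.exists_isPathCover
  refine (iInf₂_le P'' hP'').trans ?_
  exact_mod_cast hl'.trans_le (hl.trans_eq (List.length_map _))

/-! ### Heavy paths -/

/-- If the support of a flow is covered by `k` paths, then some path carries at least a `k`-th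
part of the flow. -/
theorem IsSeriesParallel.exists_carries {G : STGraph.{u, v}} (h : G.IsSeriesParallel)
    {X : G.E → ℕ} (hX : G.IsFlow X) {P : List (List G.E)}
    (hP : G.Covers P (Function.support X)) :
    ∃ p w, G.IsSTPath p ∧ G.Carries X p w ∧ G.flowValue X ≤ P.length * w := by
  induction h with
  | @single G h =>
    obtain ⟨hst, -, e, he, hs, ht⟩ := h
    refine ⟨[e], X e, ⟨⟨hs, ht⟩, by simp [ht, hst]⟩, by simp [Carries], ?_⟩
    have hu : (Finset.univ : Finset G.E) = {e} := by
      ext e'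
      simp [he e']
    have hv : G.flowValue X = X e := by
      rw [flowValue, Finset.sum_filter, hu, Finset.sum_singleton, if_pos hs]
    rw [hv]
    rcases eq_or_ne (X e) 0 with h0 | h0
    · simp [h0]
    · exact Nat.le_mul_of_pos_left _ (List.length_pos_iff.2 (hP.ne_nil ⟨e, h0⟩))
  | parallel h₁ h₂ h ih₁ ih₂ =>
    obtain ⟨f₁, f₂, φ, h⟩ := h.exists_via
    obtain ⟨P₁, P₂, hP₁, hP₂, hl⟩ :=
      h.exists_covers h₁.hasProperTerminals h₂.hasProperTerminals hP
    obtain ⟨p₁, w₁, hp₁, hw₁, hv₁⟩ := ih₁ (h.isFlow_left hX) hP₁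
    obtain ⟨p₂, w₂, hp₂, hw₂, hv₂⟩ := ih₂ (h.isFlow_right hX) hP₂
    rw [h.flowValue_eq, ← hl]
    -- The better of the two paths works: `k₁ * w₁ + k₂ * w₂ ≤ (k₁ + k₂) * max w₁ w₂`, where `k₁`,
    -- `k₂` are the sizes of the two covers.
    rcases le_total w₁ w₂ with hw | hw
    · refine ⟨_, w₂, h.isSTPath_map_right.2 hp₂, List.forall_mem_map.2 hw₂, ?_⟩
      nlinarith [Nat.mul_le_mul_left P₁.length hw]
    · refine ⟨_, w₁, h.isSTPath_map_left.2 hp₁, List.forall_mem_map.2 hw₁, ?_⟩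
      nlinarith [Nat.mul_le_mul_left P₂.length hw]
  | series h₁ h₂ h ih₁ ih₂ =>
    obtain ⟨f₁, f₂, φ, h⟩ := h.exists_via
    obtain ⟨P₁, P₂, hP₁, hP₂, hl₁, hl₂⟩ :=
      h.exists_covers h₁.hasProperTerminals h₂.hasProperTerminals hP
    obtain ⟨p₁, w₁, hp₁, hw₁, hv₁⟩ := ih₁ (h.isFlow_left hX) hP₁
    obtain ⟨p₂, w₂, hp₂, hw₂, hv₂⟩ := ih₂ (h.isFlow_right hX) hP₂
    -- Each part has the full flow value and a cover of the full size, so both `w₁` and `w₂` meet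
    -- the bound, and so does their minimum.
    refine ⟨_, min w₁ w₂, h.isSTPath_append h₂.hasProperTerminals hp₁ hp₂, fun e he => ?_, ?_⟩
    · rcases List.mem_append.1 he with he | he <;> obtain ⟨e, he', rfl⟩ := List.mem_map.1 he
      exacts [(min_le_left _ _).trans (hw₁ e he'), (min_le_right _ _).trans (hw₂ e he')]
    · rw [← Nat.mul_min_mul_left]
      refine le_min ?_ ?_
      · rwa [h.flowValue_eq_left h₁.hasProperTerminals, ← hl₁]
      · rwa [h.flowValue_eq_right h₁ h₂ hX, ← hl₂]

/-! ### The flow along a path -/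

theorem IsSTPath.nodup {G : STGraph.{u, v}} {p : List G.E} (hp : G.IsSTPath p) : p.Nodup :=
  hp.2.of_cons.of_map

theorem IsSTPath.ne_nil {G : STGraph.{u, v}} {p : List G.E} (hp : G.IsSTPath p)
    (hst : G.s ≠ G.t) : p ≠ [] := by
  rintro rfl
  exact hst hp.1

open Classical in
-- A walk leaves each vertex as often as it enters it, up to a correction at its two ends. The
-- corrections are added on opposite sides to avoid subtraction in `ℕ`.
theorem IsWalk.count_src_add {G : STGraph.{u, v}} {a b : G.V} {p : List G.E}
    (hp : G.IsWalk a p b) (c : G.V) :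
    (p.map G.src).count c + (if b = c then 1 else 0) =
      (p.map G.tgt).count c + if a = c then 1 else 0 := by
  induction p generalizing a with
  | nil =>
    obtain rfl : a = b := hp
    rfl
  | cons e p ih =>
    obtain ⟨rfl, hp⟩ := hp
    have := ih hp
    simp only [List.map_cons, List.count_cons, beq_iff_eq]
    omega

open Classical in
theorem sum_filter_pathFlow {G : STGraph.{u, v}} {p : List G.E} (hp : p.Nodup) (f : G.E → G.V)
    (c : G.V) : ∑ e with f e = c, G.pathFlow p e = (p.map f).count c := by
  have hs : (Finset.univ.filter fun e => f e = c).filter (· ∈ p) =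
      (p.filter fun e => f e = c).toFinset := by
    ext e
    simp [and_comm]
  simp only [pathFlow]
  rw [Finset.sum_boole, hs, List.toFinset_card_of_nodup (hp.filter _), List.count,
    List.countP_map, List.countP_eq_length_filter]
  simp [Function.comp_def, beq_eq_decide]

theorem IsSTPath.isFlow_pathFlow {G : STGraph.{u, v}} {p : List G.E} (hp : G.IsSTPath p) :
    G.IsFlow (G.pathFlow p) := by
  classical
  intro a hs ht
  have := hp.1.count_src_add a
  rw [if_neg hs.symm, if_neg ht.symm] at this
  rw [sum_filter_pathFlow hp.nodup, sum_filter_pathFlow hp.nodup]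
  exact this.symm

theorem IsSTPath.flowValue_pathFlow {G : STGraph.{u, v}} {p : List G.E} (hp : G.IsSTPath p)
    (hst : G.s ≠ G.t) : G.flowValue (G.pathFlow p) = 1 := by
  classical
  have := hp.1.count_src_add G.s
  rw [if_neg hst.symm, if_pos rfl,
    List.count_eq_zero_of_not_mem (List.nodup_cons.1 hp.2).1] at this
  rw [flowValue, sum_filter_pathFlow hp.nodup]
  exact this

/-! ### Single steps -/

namespace GreedyStep

variable {G : STGraph.{u, v}} {X X' : G.E → ℕ} {p : List G.E} {w : ℕ}

theorem isFlow (h : G.GreedyStep X p w X') (hX : G.IsFlow X) : G.IsFlow X' := by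
  obtain ⟨hp, -, -, rfl⟩ := h
  intro a hs ht
  have h₁ := hX a hs ht
  simp only [Pi.add_apply, Pi.smul_apply, Finset.sum_add_distrib, ← Finset.smul_sum] at h₁
  rw [hp.isFlow_pathFlow a hs ht] at h₁
  exact add_right_cancel h₁

theorem flowValue_eq (h : G.GreedyStep X p w X') (hst : G.s ≠ G.t) :
    G.flowValue X = G.flowValue X' + w := by
  obtain ⟨hp, -, -, rfl⟩ := h
  have := hp.flowValue_pathFlow hst
  rw [flowValue] at this
  simp only [flowValue, Pi.add_apply, Pi.smul_apply, Finset.sum_add_distrib, ← Finset.smul_sum,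
    this]
  rw [smul_eq_mul, mul_one]

theorem support_subset (h : G.GreedyStep X p w X') :
    Function.support X' ⊆ Function.support X := by
  obtain ⟨-, -, -, rfl⟩ := h
  intro e he
  simp only [Function.mem_support, Pi.add_apply] at he ⊢
  omega

theorem pos (h : G.GreedyStep X p w X') (hG : G.IsSeriesParallel) (hX : G.IsFlow X)
    (hne : X ≠ 0) : 0 < w := by
  obtain ⟨q, hq, hqX⟩ := hG.exists_isSTPath_of_ne_zero hX (fun _ => Nat.zero_le _) hne
  exact h.2.2.1 q 1 hq fun e he => Nat.one_le_iff_ne_zero.2 (hqX e he)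

end GreedyStep

theorem IsSeriesParallel.exists_greedyStep {G : STGraph.{u, v}} (h : G.IsSeriesParallel)
    (X : G.E → ℕ) : ∃ p w X', G.GreedyStep X p w X' := by
  classical
  let W : Set ℕ := {w | ∃ p, G.IsSTPath p ∧ G.Carries X p w}
  have hW : W.Nonempty := by
    obtain ⟨p, hp⟩ := h.exists_isSTPath
    exact ⟨0, p, hp, fun _ _ => Nat.zero_le _⟩
  -- As `s ≠ t`, a path has at least one edge, whose flow bounds what the path carries; an empty
  -- path would carry every weight.
  have hb : BddAbove W := by
    refine ⟨∑ e, X e, ?_⟩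
    rintro w ⟨p, hp, hw⟩
    obtain ⟨e, he⟩ := List.exists_mem_of_ne_nil p (hp.ne_nil h.hasProperTerminals.s_ne_t)
    exact (hw e he).trans (Finset.single_le_sum (fun _ _ => Nat.zero_le _) (Finset.mem_univ e))
  obtain ⟨p, hp, hw⟩ := Nat.sSup_mem hW hb
  refine ⟨p, sSup W, X - sSup W • G.pathFlow p, hp, hw,
    fun q w' hq hw' => le_csSup hb ⟨q, hq, hw'⟩, ?_⟩
  -- The subtraction is not truncated, since the path carries the weight that is removed.
  rw [tsub_add_cancel_of_le]
  intro e
  by_cases he : e ∈ p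
  · simpa [pathFlow, he] using hw e he
  · simp [pathFlow, he]

/-! ### Runs -/

/-- Each step from a nonzero flow removes a positive weight, so the flow value strictly decreases.
-/
theorem IsSeriesParallel.acc_greedyStep {G : STGraph.{u, v}} (h : G.IsSeriesParallel)
    {X : G.E → ℕ} (hX : G.IsFlow X) :
    Acc (fun X₂ X₁ : G.E → ℕ => X₁ ≠ 0 ∧ ∃ p w, G.GreedyStep X₁ p w X₂) X := by
  induction hn : G.flowValue X using Nat.strong_induction_on generalizing X with
  | _ n ih =>
    refine ⟨_, fun X' ⟨hne, p, w, hstep⟩ => ih _ ?_ (hstep.isFlow hX) rfl⟩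
    have := hstep.flowValue_eq h.hasProperTerminals.s_ne_t
    have := hstep.pos h hX hne
    omega

namespace GreedyRun

variable {G : STGraph.{u, v}} {X X' : G.E → ℕ} {L : List (List G.E × ℕ)}

theorem isSTPath_and_eq_add_sum (h : G.GreedyRun X L X') :
    (∀ d ∈ L, G.IsSTPath d.1) ∧ X = X' + (L.map fun d => d.2 • G.pathFlow d.1).sum := by
  induction h with
  | nil X => simp
  | cons _ hstep _ ih =>
    refine ⟨List.forall_mem_cons.2 ⟨hstep.1, ih.1⟩, hstep.2.2.2.trans ?_⟩
    rw [List.map_cons, List.sum_cons, add_left_comm, ← ih.2, add_comm]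

theorem isFlowDecomposition (h : G.GreedyRun X L 0) : G.IsFlowDecomposition X L := by
  simpa [IsFlowDecomposition] using h.isSTPath_and_eq_add_sum

theorem eq_nil (h : G.GreedyRun 0 L X') : L = [] := by
  cases h with
  | nil => rfl
  | cons hne => exact (hne rfl).elim

theorem length_le_flowValue (h : G.GreedyRun X L X') (hG : G.IsSeriesParallel)
    (hX : G.IsFlow X) : L.length ≤ G.flowValue X := by
  induction h with
  | nil X => simp
  | cons hne hstep _ ih =>
    have := ih (hstep.isFlow hX)
    have := hstep.flowValue_eq hG.hasProperTerminals.s_ne_t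
    have := hstep.pos hG hX hne
    simp only [List.length_cons]
    omega

/-- The number of steps is logarithmic in the flow and linear in the size of a path cover. -/
theorem length_le_of_covers (h : G.GreedyRun X L X') (hG : G.IsSeriesParallel)
    (hX : G.IsFlow X) (hne : X ≠ 0) {P : List (List G.E)} {S : Set G.E}
    (hS : Function.support X ⊆ S) (hP : G.Covers P S) :
    (L.length : ℝ) ≤ P.length * (1 + Real.log (G.flowValue X : ℕ)) := by
  have hlog (n : ℕ) : 0 ≤ Real.log n := Real.log_natCast_nonneg n
  induction h with
  | nil X =>
    have := hlog (G.flowValue X)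
    simp only [List.length_nil, Nat.cast_zero]
    positivity
  | @cons X X' X'' p w L _ hstep hrun ih =>
    -- `P` and `S` stay fixed along the run; the current support gets a cover that is no larger than
    -- `P`.
    obtain ⟨P', hP', hl⟩ := hG.exists_covers_support hX (fun _ => Nat.zero_le _) hS hP
    obtain ⟨q, w', hq, hqw, hv⟩ := hG.exists_carries hX hP'
    have hvw : G.flowValue X ≤ P.length * w :=
      hv.trans (Nat.mul_le_mul hl (hstep.2.2.1 q w' hq hqw))
    have hpos : 0 < G.flowValue X :=
      Nat.pos_of_ne_zero (mt (hG.eq_zero_of_flowValue_eq_zero hX (fun _ => Nat.zero_le _)) hne)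
    have hval := hstep.flowValue_eq hG.hasProperTerminals.s_ne_t
    have hX' := hstep.isFlow hX
    have hpos' : (0 : ℝ) < (G.flowValue X : ℕ) := by exact_mod_cast hpos
    -- The logarithmic estimate needs a positive remaining value, so the last step is counted by the
    -- summand `1`, which suffices because `P` is nonempty.
    rcases eq_or_ne X' 0 with rfl | hne'
    · have hk : 1 ≤ P.length := Nat.pos_of_ne_zero fun h0 => by simp [h0] at hvw; omega
      have hk' : (1 : ℝ) ≤ P.length := by exact_mod_cast hk
      rw [hrun.eq_nil]
      simp only [List.length_cons, List.length_nil, zero_add, Nat.cast_one]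
      nlinarith [hlog (G.flowValue X)]
    · have hL := ih hX' hne' (hstep.support_subset.trans hS)
      have hv' : (0 : ℝ) < (G.flowValue X' : ℕ) := by
        exact_mod_cast Nat.pos_of_ne_zero
          (mt (hG.eq_zero_of_flowValue_eq_zero hX' (fun _ => Nat.zero_le _)) hne')
      -- This is `log x ≤ x - 1` at the ratio of the new value to the old one, which is `1 - w /
      -- |X|`.
      have hdiff : Real.log (G.flowValue X' : ℕ) + w / (G.flowValue X : ℕ) ≤
          Real.log (G.flowValue X : ℕ) := by
        have h₁ := Real.log_le_sub_one_of_pos (div_pos hv' hpos')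
        rw [Real.log_div hv'.ne' hpos'.ne'] at h₁
        have h₂ : ((G.flowValue X' : ℕ) : ℝ) / (G.flowValue X : ℕ) = 1 - w / (G.flowValue X : ℕ) := by
          rw [eq_sub_iff_add_eq, ← add_div, div_eq_one_iff_eq hpos'.ne', hval]
          push_cast
          rfl
        linarith
      have hone : (1 : ℝ) ≤ P.length * (w / (G.flowValue X : ℕ)) := by
        rw [← mul_div_assoc, one_le_div hpos']
        exact_mod_cast hvw
      have hmul := mul_le_mul_of_nonneg_left hdiff (Nat.cast_nonneg (α := ℝ) P.length)
      simp only [List.length_cons, Nat.cast_add, Nat.cast_one]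
      linarith

end GreedyRun

/-! ### Flow decompositions -/

/-- There is no cancellation in `ℕ`, so the paths of nonzero weight cover exactly the support. Paths
of weight `0` are dropped because they may leave it. -/
theorem IsFlowDecomposition.exists_covers {G : STGraph.{u, v}} {X : G.E → ℕ}
    {D : List (List G.E × ℕ)} (h : G.IsFlowDecomposition X D) :
    ∃ P, G.Covers P (Function.support X) ∧ P.length ≤ D.length := by
  classical
  obtain ⟨hD, hX⟩ := h
  have hsup (e : G.E) : X e ≠ 0 ↔ ∃ d ∈ D, d.2 ≠ 0 ∧ e ∈ d.1 := by
    rw [hX, Pi.list_sum_apply, Ne, List.sum_eq_zero_iff]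
    simp [pathFlow, and_comm]
  refine ⟨(D.filter fun d => d.2 ≠ 0).map Prod.fst, ⟨?_, ?_, fun e he => ?_⟩, ?_⟩
  · exact List.forall_mem_map.2 fun d hd => hD d (List.mem_filter.1 hd).1
  · refine List.forall_mem_map.2 fun d hd e he => (hsup e).2 ⟨d, ?_, ?_, he⟩
    · exact (List.mem_filter.1 hd).1
    · simpa using (List.mem_filter.1 hd).2
  · obtain ⟨d, hd, hd0, hed⟩ := (hsup e).1 he
    exact ⟨d.1, List.mem_map_of_mem (List.mem_filter.2 ⟨hd, by simpa using hd0⟩), hed⟩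
  · rw [List.length_map]
    exact List.length_filter_le _ _

/-- Some decomposition must be supplied because `sInf ∅ = 0`; below, the output of greedy-weight
plays this role. -/
theorem IsFlowDecomposition.exists_length_eq_mfdSize {G : STGraph.{u, v}} {X : G.E → ℕ}
    {D : List (List G.E × ℕ)} (h : G.IsFlowDecomposition X D) :
    ∃ D', G.IsFlowDecomposition X D' ∧ D'.length = G.mfdSize X :=
  Nat.sInf_mem (s := {k | ∃ D, G.IsFlowDecomposition X D ∧ D.length = k}) ⟨_, D, h, rfl⟩

theorem IsSeriesParallel.greedyApproximates {G : STGraph.{u, v}} (h : G.IsSeriesParallel)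
    {X : G.E → ℕ} (hX : G.IsFlow X) {α : ℝ}
    (hα : ∀ L, G.GreedyRun X L 0 → (L.length : ℝ) ≤ α * (G.mfdSize X : ℝ)) :
    G.GreedyApproximates X α where
  progress _ X' _ _ := h.exists_greedyStep X'
  terminates := h.acc_greedyStep hX
  isFlowDecomposition _ hL := hL.isFlowDecomposition
  length_le := hα

theorem GreedyRun.length_le_mul_mfdSize {G : STGraph.{u, v}} {X : G.E → ℕ}
    {L : List (List G.E × ℕ)} (h : G.GreedyRun X L 0) (hG : G.IsSeriesParallel)
    (hX : G.IsFlow X) (hv : 2 ≤ G.flowValue X) :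
    (L.length : ℝ) ≤ (1 / Real.log 2 + 1) * Real.log (G.flowValue X : ℕ) * G.mfdSize X := by
  have hne : X ≠ 0 := by
    rintro rfl
    simp [flowValue_zero] at hv
  obtain ⟨D, hD, hDl⟩ := h.isFlowDecomposition.exists_length_eq_mfdSize
  obtain ⟨P, hP, hPl⟩ := hD.exists_covers
  have hlog : Real.log 2 ≤ Real.log (G.flowValue X : ℕ) :=
    Real.log_le_log two_pos (by exact_mod_cast hv)
  have hlog2 : 0 < Real.log 2 := Real.log_pos one_lt_two
  -- Source of the constant `1 / Real.log 2 + 1`: for `|X| ≥ 2` the summand `1` of the step bound is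
  -- absorbed into a multiple of `log |X|`.
  have hone : 1 ≤ 1 / Real.log 2 * Real.log (G.flowValue X : ℕ) := by
    rwa [one_div_mul_eq_div, one_le_div hlog2]
  calc (L.length : ℝ) ≤ P.length * (1 + Real.log (G.flowValue X : ℕ)) :=
        h.length_le_of_covers hG hX hne subset_rfl hP
    _ ≤ G.mfdSize X * ((1 / Real.log 2 + 1) * Real.log (G.flowValue X : ℕ)) := by
        refine mul_le_mul (by exact_mod_cast hPl.trans_eq hDl) (by linarith) (by linarith)
          (Nat.cast_nonneg _)
    _ = _ := mul_comm _ _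

theorem GreedyRun.length_le_mfdSize {G : STGraph.{u, v}} {X : G.E → ℕ}
    {L : List (List G.E × ℕ)} (h : G.GreedyRun X L 0) (hG : G.IsSeriesParallel)
    (hX : G.IsFlow X) (hv : G.flowValue X ≤ 1) : L.length ≤ G.mfdSize X := by
  rcases eq_or_ne X 0 with rfl | hne
  · simp [h.eq_nil]
  -- At most one step is made, and a nonzero flow has no empty decomposition.
  refine ((h.length_le_flowValue hG hX).trans hv).trans (Nat.pos_of_ne_zero fun h0 => hne ?_)
  obtain ⟨D, hD, hDl⟩ := h.isFlowDecomposition.exists_length_eq_mfdSize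
  rw [h0, List.length_eq_zero_iff] at hDl
  simpa [hDl] using hD.2

end STGraph

theorem mainTheorem5 :
    (∀ G : STGraph.{u, v}, G.IsSeriesParallel → G.WidthStable) ∧
    ∃ C : ℝ, ∀ G : STGraph.{u, v}, G.IsSeriesParallel →
      ∀ X : G.E → ℕ, G.IsFlow X →
        (2 ≤ G.flowValue X →
          G.GreedyApproximates X (C * Real.log ((G.flowValue X : ℕ) : ℝ))) ∧
        (G.flowValue X ≤ 1 → G.GreedyApproximates X 1) := by
  refine ⟨fun G h => h.widthStable, 1 / Real.log 2 + 1,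
    fun G h X hX => ⟨fun hv => ?_, fun hv => ?_⟩⟩
  · exact h.greedyApproximates hX fun L hL => hL.length_le_mul_mfdSize h hX hv
  · refine h.greedyApproximates hX fun L hL => ?_
    rw [one_mul]
    exact_mod_cast hL.length_le_mfdSize h hX hv
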